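/- Let $d\ge 1$, let $q_1,\dots,q_d$ be positive integers, $Q=q_1q_2\cdots q_d$, $\Gamma=q_1\mathbb{Z}\oplus\cdots\oplus q_d\mathbb{Z}$, and let $V:\mathbb{Z}^d\to\mathbb{R}$ be $\Gamma$-periodic, i.e. $V(n+\gamma)=V(n)$ for all $n\in\mathbb{Z}^d$, $\gamma\in\Gamma$. Let $\Delta$ be the discrete Laplacian, $(\Delta u)(n)=\sum_{\|n'-n\|_1=1}u(n')$ for $u:\mathbb{Z}^d\to\mathbb{C}$. For $k\in\mathbb{R}^d$ let $D_V(k)$ be the operator $\Delta+V$ acting on the functions $u:\mathbb{Z}^d\to\mathbb{C}$ with the Floquet--Bloch boundary condition $$u(n+q_j\mathbf{e}_j)=e^{2\pi i k_j}u(n),\qquad j=1,\dots,d,\ n\in\mathbb{Z}^d,$$ where $\mathbf{e}_1,\dots,\mathbf{e}_d$ is the standard basis; in terms of the values of $u$ on $\{n: 0\le n_j\le q_j-1\}$ it is a Hermitian $Q\times Q$ matrix. Let $\lambda_V^1(k)\le\lambda_V^2(k)\le\cdots\le\lambda_V^Q(k)$ be its eigenvalues, counted with multiplicity, and let $L_N^d=\{0,1,\dots,N-1\}^d$.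 Then for all $s,w\in\{1,\dots,Q\}$, $$\lim_{N\to\infty}\ \sup_{\substack{m\in L_N^d\\ m\ne 0}}\ \frac{\#\{r\in L_N^d:\ \lambda_V^s(\frac{r+m}{N})-\lambda_V^w(\frac{r}{N})=0\}}{N^d}=0 .$$ -/

import Mathlib

open Filter Topology

noncomputable section

namespace PeriodicSchrodinger

/-- The nearest neighbours of `n` in `ℤ^d`: all `n'` with `‖n - n'‖₁ = 1`
(see `mem_neighbors`; the box only makes the finiteness visible). -/
def neighbors {d : ℕ} (n : Fin d → ℤ) : Finset (Fin d → ℤ) :=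
  {n' ∈ Finset.Icc (n - 1) (n + 1) | ∑ i, |n i - n' i| = 1}

theorem mem_neighbors {d : ℕ} (n n' : Fin d → ℤ) :
    n' ∈ neighbors n ↔ ∑ i, |n i - n' i| = 1 := by
  unfold neighbors
  rw [Finset.mem_filter, and_iff_right_iff_imp]
  intro h
  have key : ∀ i, |n i - n' i| ≤ 1 := fun i => by
    rw [← h]
    exact Finset.single_le_sum (f := fun i => |n i - n' i|) (fun i _ => abs_nonneg _)
      (Finset.mem_univ i)
  rw [Finset.mem_Icc]
  constructor <;> intro i <;> have := abs_le.mp (key i) <;>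
    simp only [Pi.sub_apply, Pi.add_apply, Pi.one_apply] <;> omega

/-- The discrete Laplacian `(Δu)(n) = ∑_{‖n' - n‖₁ = 1} u(n')` on functions `ℤ^d → ℂ`. -/
def laplacian (d : ℕ) : ((Fin d → ℤ) → ℂ) →ₗ[ℂ] ((Fin d → ℤ) → ℂ) where
  toFun u := fun n => ∑ n' ∈ neighbors n, u n'
  map_add' u v := by
    funext n
    simp [Finset.sum_add_distrib]
  map_smul' c u := by
    funext n
    simp [Finset.mul_sum]

/-- Multiplication by the real potential `V`. -/
def potential {d : ℕ} (V : (Fin d → ℤ) → ℝ) :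
    ((Fin d → ℤ) → ℂ) →ₗ[ℂ] ((Fin d → ℤ) → ℂ) where
  toFun u := fun n => (V n : ℂ) * u n
  map_add' u v := by
    funext n
    simp [mul_add]
  map_smul' c u := by
    funext n
    simp [mul_left_comm]

/-- The discrete Schrödinger operator `Δ + V`. -/
def schrodinger {d : ℕ} (V : (Fin d → ℤ) → ℝ) :
    ((Fin d → ℤ) → ℂ) →ₗ[ℂ] ((Fin d → ℤ) → ℂ) :=
  laplacian d + potential V

/-- `V` is `Γ`-periodic for `Γ = q₁ℤ ⊕ ⋯ ⊕ q_dℤ`. -/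
def IsPeriodic {d : ℕ} (q : Fin d → ℕ) (V : (Fin d → ℤ) → ℝ) : Prop :=
  ∀ γ : Fin d → ℤ, (∀ j, (q j : ℤ) ∣ γ j) → ∀ n, V (n + γ) = V n

/-- The Floquet-Bloch boundary condition `u(n + q_j e_j) = e^{2πi k_j} u(n)`. -/
def IsFloquet {d : ℕ} (q : Fin d → ℕ) (k : Fin d → ℝ) (u : (Fin d → ℤ) → ℂ) : Prop :=
  ∀ (j : Fin d) (n : Fin d → ℤ),
    u (n + Pi.single j (q j : ℤ)) = Complex.exp (2 * Real.pi * Complex.I * k j) * u n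

/-- The fundamental cell `{n : 0 ≤ n_j ≤ q_j - 1}`, of cardinality `Q = q₁ ⋯ q_d`. -/
abbrev Cell {d : ℕ} (q : Fin d → ℕ) : Type := (j : Fin d) → Fin (q j)

/-- A point of the fundamental cell, seen in `ℤ^d`. -/
def Cell.toLattice {d : ℕ} {q : Fin d → ℕ} (a : Cell q) : Fin d → ℤ := fun j => ((a j : ℕ) : ℤ)

/-- The function on `ℤ^d` that satisfies the Floquet-Bloch boundary condition and that is `1` at
the point `a` of the fundamental cell and `0` at the other points of the cell
(see `isFloquet_floquetBasis` and `floquetBasis_toLattice`). -/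
def floquetBasis {d : ℕ} (q : Fin d → ℕ) (k : Fin d → ℝ) (a : Cell q) : (Fin d → ℤ) → ℂ :=
  fun n =>
    if ∀ j, (q j : ℤ) ∣ n j - a.toLattice j then
      Complex.exp (2 * Real.pi * Complex.I *
        ∑ j, (k j : ℂ) * (((n j - a.toLattice j) / (q j : ℤ) : ℤ) : ℂ))
    else 0

/-- The `Q × Q` matrix `D_V(k)` of `Δ + V` with the Floquet-Bloch boundary condition
(see `floquetMatrix_mulVec`). -/
def floquetMatrix {d : ℕ} (q : Fin d → ℕ) (V : (Fin d → ℤ) → ℝ) (k : Fin d → ℝ) :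
    Matrix (Cell q) (Cell q) ℂ :=
  Matrix.of fun a b => schrodinger V (floquetBasis q k b) a.toLattice

theorem isFloquet_floquetBasis {d : ℕ} (q : Fin d → ℕ) (hq : ∀ j, 0 < q j) (k : Fin d → ℝ)
    (a : Cell q) : IsFloquet q k (floquetBasis q k a) := by
  intro j n
  have hiff : (∀ i, (q i : ℤ) ∣ (n + Pi.single j (q j : ℤ) : Fin d → ℤ) i - a.toLattice i) ↔
      ∀ i, (q i : ℤ) ∣ n i - a.toLattice i := by
    refine forall_congr' fun i => ?_
    by_cases hij : i = j
    · subst hij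
      have : (n + Pi.single i (q i : ℤ) : Fin d → ℤ) i - a.toLattice i = (n i - a.toLattice i) + q i := by
        simp; ring
      rw [this, dvd_add_self_right]
    · simp [hij]
  unfold floquetBasis
  by_cases h : ∀ i, (q i : ℤ) ∣ n i - a.toLattice i
  · rw [if_pos (hiff.mpr h), if_pos h, ← Complex.exp_add, ← mul_add]
    congr 2
    have : ∀ i, (k i : ℂ) *
        ((((n + Pi.single j (q j : ℤ) : Fin d → ℤ) i - a.toLattice i) / (q i : ℤ) : ℤ) : ℂ) =
        (if i = j then (k j : ℂ) else 0) +
          (k i : ℂ) * (((n i - a.toLattice i) / (q i : ℤ) : ℤ) : ℂ) := by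
      intro i
      by_cases hij : i = j
      · subst hij
        have h1 : (n + Pi.single i (q i : ℤ) : Fin d → ℤ) i - a.toLattice i =
            (n i - a.toLattice i) + q i := by
          simp; ring
        have h2 : (q i : ℤ) ≠ 0 := by exact_mod_cast (hq i).ne'
        rw [h1, Int.add_ediv_of_dvd_right (dvd_refl _), Int.ediv_self h2]
        push_cast
        simp; ring
      · simp [hij]
    rw [Finset.sum_congr rfl fun i _ => this i, Finset.sum_add_distrib]
    simp
  · rw [if_neg (fun h' => h (hiff.mp h')), if_neg h, mul_zero]

theorem Cell.eq_of_dvd {d : ℕ} {q : Fin d → ℕ} (a b : Cell q)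
    (h : ∀ j, (q j : ℤ) ∣ b.toLattice j - a.toLattice j) : b = a := by
  funext j
  have h1 := Int.eq_zero_of_abs_lt_dvd (h j) (by
    have := (a j).isLt
    have := (b j).isLt
    unfold Cell.toLattice
    rw [abs_lt]
    omega)
  unfold Cell.toLattice at h1
  ext
  omega

theorem floquetBasis_toLattice {d : ℕ} (q : Fin d → ℕ) (k : Fin d → ℝ) (a b : Cell q) :
    floquetBasis q k a b.toLattice = if b = a then 1 else 0 := by
  unfold floquetBasis
  by_cases h : b = a
  · subst h
    simp
  · rw [if_neg h, if_neg (fun h' => h (Cell.eq_of_dvd a b h'))]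

/-- The representative in the fundamental cell of a lattice point. -/
def residue {d : ℕ} (q : Fin d → ℕ) (hq : ∀ j, 0 < q j) (n : Fin d → ℤ) : Cell q :=
  fun j => ⟨(n j % (q j : ℤ)).toNat, by
    have h := hq j
    have h1 := Int.emod_nonneg (n j) (b := (q j : ℤ)) (by omega)
    have h2 := Int.emod_lt_of_pos (n j) (b := (q j : ℤ)) (by omega)
    omega⟩

theorem residue_toLattice {d : ℕ} (q : Fin d → ℕ) (hq : ∀ j, 0 < q j) (n : Fin d → ℤ)
    (j : Fin d) : (residue q hq n).toLattice j = n j % (q j : ℤ) := by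
  have h := hq j
  have h1 := Int.emod_nonneg (n j) (b := (q j : ℤ)) (by omega)
  simp only [residue, Cell.toLattice]
  omega

/-- A function with the Floquet-Bloch boundary condition is determined by its values on the cell. -/
theorem IsFloquet.eq_zero {d : ℕ} {q : Fin d → ℕ} (hq : ∀ j, 0 < q j) {k : Fin d → ℝ}
    {u : (Fin d → ℤ) → ℂ} (hu : IsFloquet q k u) (h0 : ∀ a : Cell q, u a.toLattice = 0) :
    u = 0 := by
  have step : ∀ (j : Fin d) (c : ℤ) (n : Fin d → ℤ),
      u (n + Pi.single j (c * (q j : ℤ))) = 0 ↔ u n = 0 := by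
    intro j c
    induction c using Int.induction_on with
    | zero => intro n; simp
    | succ c ih =>
      intro n
      rw [← ih n, add_mul, one_mul, Pi.single_add, ← add_assoc, hu j]
      simp
    | pred c ih =>
      intro n
      rw [← ih n]
      have : n + Pi.single j (-(c : ℤ) * (q j : ℤ)) =
          (n + Pi.single j ((-(c : ℤ) - 1) * (q j : ℤ))) + Pi.single j (q j : ℤ) := by
        rw [add_assoc, ← Pi.single_add]
        congr 2
        ring
      rw [this, hu j]
      simp
  have many : ∀ (t : Finset (Fin d)) (c : Fin d → ℤ) (n : Fin d → ℤ),
      u (n + ∑ j ∈ t, Pi.single j (c j * (q j : ℤ))) = 0 ↔ u n = 0 := by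
    intro t c
    induction t using Finset.induction_on with
    | empty => intro n; simp
    | insert j t hj ih =>
      intro n
      rw [Finset.sum_insert hj, ← add_assoc, ih, step]
  funext n
  have h1 : (residue q hq n).toLattice +
      ∑ j, Pi.single j ((n j / (q j : ℤ)) * (q j : ℤ)) = n := by
    funext i
    rw [Pi.add_apply, Finset.univ_sum_single (fun j => (n j / (q j : ℤ)) * (q j : ℤ)),
      residue_toLattice]
    exact Int.emod_add_ediv_mul (n i) (q i : ℤ)
  rw [← h1]
  exact (many _ _ _).mpr (h0 _)

theorem IsFloquet.eq_sum {d : ℕ} {q : Fin d → ℕ} (hq : ∀ j, 0 < q j) {k : Fin d → ℝ}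
    {u : (Fin d → ℤ) → ℂ} (hu : IsFloquet q k u) :
    u = ∑ a : Cell q, u a.toLattice • floquetBasis q k a := by
  refine sub_eq_zero.mp (IsFloquet.eq_zero hq (k := k) ?_ ?_)
  · intro j n
    have hb : ∀ a : Cell q, floquetBasis q k a (n + Pi.single j (q j : ℤ)) = _ :=
      fun a => isFloquet_floquetBasis q hq k a j n
    simp only [Pi.sub_apply, Finset.sum_apply, Pi.smul_apply, smul_eq_mul, hu j n, hb, mul_sub,
      Finset.mul_sum]
    congr 1
    exact Finset.sum_congr rfl fun a _ => by ring
  · intro b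
    simp [floquetBasis_toLattice]

/-- For `u` with the Floquet-Bloch boundary condition, `D_V(k)` maps the values of `u` on the
fundamental cell to the values of `(Δ + V)u` there. -/
theorem floquetMatrix_mulVec {d : ℕ} (q : Fin d → ℕ) (hq : ∀ j, 0 < q j)
    (V : (Fin d → ℤ) → ℝ) (k : Fin d → ℝ) (u : (Fin d → ℤ) → ℂ) (hu : IsFloquet q k u)
    (a : Cell q) :
    (floquetMatrix q V k).mulVec (fun b => u b.toLattice) a = schrodinger V u a.toLattice := by
  conv_rhs => rw [hu.eq_sum hq]
  simp only [map_sum, map_smul, Finset.sum_apply, Pi.smul_apply, smul_eq_mul, Matrix.mulVec,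
    dotProduct, floquetMatrix, Matrix.of_apply]
  exact Finset.sum_congr rfl fun b _ => mul_comm _ _

theorem floquetMatrix_isHermitian {d : ℕ} (q : Fin d → ℕ) (V : (Fin d → ℤ) → ℝ)
    (k : Fin d → ℝ) : (floquetMatrix q V k).IsHermitian := by
  ext a b
  rw [Matrix.conjTranspose_apply]
  simp only [floquetMatrix, Matrix.of_apply, schrodinger, LinearMap.add_apply, Pi.add_apply,
    laplacian, potential, LinearMap.coe_mk, AddHom.coe_mk, floquetBasis_toLattice, star_add,
    star_sum]
  congr 1
  · refine Finset.sum_nbij' (fun l => a.toLattice + b.toLattice - l)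
      (fun l => a.toLattice + b.toLattice - l) ?_ ?_ ?_ ?_ ?_
    · intro l hl
      rw [mem_neighbors] at hl ⊢
      rw [← hl]
      refine Finset.sum_congr rfl fun i _ => ?_
      rw [← abs_neg]
      simp only [Pi.add_apply, Pi.sub_apply]
      congr 1
      ring
    · intro l hl
      rw [mem_neighbors] at hl ⊢
      rw [← hl]
      refine Finset.sum_congr rfl fun i _ => ?_
      rw [← abs_neg]
      simp only [Pi.add_apply, Pi.sub_apply]
      congr 1
      ring
    · intro l _
      simp
    · intro l _
      simp
    · intro l _
      have e : ∀ j, (a.toLattice + b.toLattice - l) j - b.toLattice j =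
          -(l j - a.toLattice j) := by
        intro j
        simp only [Pi.add_apply, Pi.sub_apply]
        ring
      unfold floquetBasis
      simp only [e, dvd_neg]
      by_cases h : ∀ j, (q j : ℤ) ∣ l j - a.toLattice j
      · rw [if_pos h, if_pos h, Complex.star_def, ← Complex.exp_conj]
        congr 1
        simp only [map_mul, map_sum, Complex.conj_ofReal, Complex.conj_I, Complex.conj_ofNat,
          map_intCast, Int.neg_ediv_of_dvd (h _)]
        push_cast
        simp
      · rw [if_neg h, if_neg h, star_zero]
  · by_cases h : a = b
    · subst h
      simp
    · simp [h, Ne.symm h]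

theorem card_cell {d : ℕ} (q : Fin d → ℕ) : ∏ j, q j = Fintype.card (Cell q) := by
  simp [Cell]

/-- The spectral band functions: `band q V j k` is the `j`-th eigenvalue of `D_V(k)` in
non-decreasing order, counted with multiplicity (Mathlib's `eigenvalues₀` lists the eigenvalues of
a Hermitian matrix in non-increasing order). The index `j` runs over `Fin Q`, `Q = q₁ ⋯ q_d`. -/
def band {d : ℕ} (q : Fin d → ℕ) (V : (Fin d → ℤ) → ℝ) (j : Fin (∏ i, q i)) (k : Fin d → ℝ) : ℝ :=
  (floquetMatrix_isHermitian q V k).eigenvalues₀ (Fin.rev (Fin.cast (card_cell q) j))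

theorem band_monotone {d : ℕ} (q : Fin d → ℕ) (V : (Fin d → ℤ) → ℝ) (k : Fin d → ℝ) :
    Monotone fun j => band q V j k := by
  intro i j hij
  refine (floquetMatrix_isHermitian q V k).eigenvalues₀_antitone ?_
  rw [Fin.rev_le_rev]
  exact hij

/-- `L_N^d = {0, 1, …, N - 1}^d`. -/
def box (d N : ℕ) : Finset (Fin d → ℕ) := Fintype.piFinset fun _ => Finset.range N

end PeriodicSchrodinger

end

/-!
In the gauge `v(n) = e^{-2πi ∑ k_j n_j / q_j} u(n)` the operator `D_V(k)` becomes
`G(x) = ∑_{‖e‖₁ = 1} x ^ e S_e + V`, where `S_e` are the translations of the cell and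
`x_j = e^{2πi k_j / q_j}`. If `G(y x)` and `G(x)` have a common eigenvalue then the determinant of
the Sylvester operator `X ↦ G(y x) X - X G(x)` vanishes. As a function of `x` this determinant is
a Laurent polynomial whose degree is bounded independently of `y`. It is not identically zero when
`y_j ^ q_j ≠ 1` for some `j`: with the other coordinates equal to `1`, as `x_j → ∞` the matrices
`x_j⁻¹ G(y x)` and `x_j⁻¹ G(x)` tend to `y_j S` and `S` with `S ^ q_j = 1`, and `y_j ^ q_j ≠ 1`
separates their spectra. By the Schwartz-Zippel lemma the determinant has `O(N ^ (d - 1))` zeros on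
the grid of the `x` with `k ∈ N⁻¹ L_N^d`, uniformly in `y`.
-/

noncomputable section

namespace PeriodicSchrodinger

open scoped Kronecker Matrix

section Sylvester

variable {m n R K : Type*} [DecidableEq m] [DecidableEq n] [CommRing R] [Field K]

/-- The matrix `A ⊗ 1 - 1 ⊗ B` of the Sylvester operator `X ↦ X Aᵀ - B X`. Its determinant is, up
to sign, the resultant of the characteristic polynomials of `A` and `B`. -/
def sylvester (A : Matrix m m R) (B : Matrix n n R) : Matrix (m × n) (m × n) R :=
  A ⊗ₖ 1 - 1 ⊗ₖ B

theorem sylvester_smul (c : R) (A : Matrix m m R) (B : Matrix n n R) :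
    sylvester (c • A) (c • B) = c • sylvester A B := by
  rw [sylvester, sylvester, Matrix.smul_kronecker, Matrix.kronecker_smul, smul_sub]

variable [Fintype m] [Fintype n]

theorem kronecker_pow (A : Matrix m m R) (B : Matrix n n R) (k : ℕ) :
    (A ⊗ₖ B) ^ k = (A ^ k) ⊗ₖ (B ^ k) := by
  induction k with
  | zero => simp
  | succ k ih => simp only [pow_succ, ih, Matrix.mul_kronecker_mul]

theorem det_sylvester_eq_zero_of_mem_spectrum {A : Matrix m m K} {B : Matrix n n K} {c : K}
    (hA : c ∈ spectrum K A) (hB : c ∈ spectrum K B) : (sylvester A B).det = 0 := by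
  rw [← Matrix.spectrum_toLin', ← Module.End.hasEigenvalue_iff_mem_spectrum] at hA hB
  obtain ⟨u, hu⟩ := hA.exists_hasEigenvector
  obtain ⟨v, hv⟩ := hB.exists_hasEigenvector
  have hAu : A *ᵥ u = c • u := by simpa using hu.apply_eq_smul
  have hBv : B *ᵥ v = c • v := by simpa using hv.apply_eq_smul
  refine Matrix.exists_mulVec_eq_zero_iff.mp ⟨(Matrix.vecMulVec v u).vec, ?_, ?_⟩
  · obtain ⟨i, hi⟩ := Function.ne_iff.mp hu.2
    obtain ⟨j, hj⟩ := Function.ne_iff.mp hv.2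
    exact Function.ne_iff.mpr ⟨(i, j), mul_ne_zero hj hi⟩
  · rw [sylvester, Matrix.sub_mulVec, Matrix.kronecker_mulVec_vec, Matrix.kronecker_mulVec_vec,
      Matrix.one_mul, Matrix.transpose_one, Matrix.mul_one, Matrix.vecMulVec_mul,
      Matrix.vecMul_transpose, Matrix.mul_vecMulVec, hAu, hBv, Matrix.smul_vecMulVec,
      Matrix.vecMulVec_smul, sub_self]

theorem det_sylvester_ne_zero_of_pow [IsDomain R] {A : Matrix m m R} {B : Matrix n n R} {k : ℕ}
    {c c' : R} (hA : A ^ k = c • 1) (hB : B ^ k = c' • 1) (hc : c ≠ c') :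
    (sylvester A B).det ≠ 0 := by
  have hcomm : Commute (A ⊗ₖ (1 : Matrix n n R)) ((1 : Matrix m m R) ⊗ₖ B) := by
    simp [Commute, SemiconjBy, ← Matrix.mul_kronecker_mul]
  have hfactor := hcomm.mul_geom_sum₂ k
  rw [kronecker_pow, kronecker_pow, one_pow, one_pow, hA, hB, Matrix.smul_kronecker,
    Matrix.kronecker_smul, Matrix.one_kronecker_one, ← sub_smul] at hfactor
  intro h
  have hdet := congrArg Matrix.det hfactor
  rw [Matrix.det_mul, ← sylvester, h, zero_mul, Matrix.det_smul, Matrix.det_one, mul_one] at hdet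
  exact pow_ne_zero _ (sub_ne_zero.mpr hc) hdet.symm

end Sylvester

section Laurent

variable {d : ℕ} {K : Type*} [Field K]

/-- The functions that agree on `(K \ {0})^d` with a Laurent polynomial all of whose exponents lie
in `[-M, M]`; the values at points with a zero coordinate are irrelevant. -/
def laurentDegreeLE (d : ℕ) (K : Type*) [Field K] (M : ℕ) : Submodule K ((Fin d → K) → K) where
  carrier := {f | ∃ p : MvPolynomial (Fin d) K, (∀ i, p.degreeOf i ≤ 2 * M) ∧
    ∀ x, (∀ i, x i ≠ 0) → (∏ i, x i) ^ M * f x = p.eval x}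
  zero_mem' := ⟨0, by simp, by simp⟩
  add_mem' := by
    rintro f g ⟨p, hp, hfp⟩ ⟨p', hp', hgp'⟩
    refine ⟨p + p', fun i => (MvPolynomial.degreeOf_add_le i p p').trans (max_le (hp i) (hp' i)),
      fun x hx => ?_⟩
    rw [Pi.add_apply, mul_add, hfp x hx, hgp' x hx, map_add]
  smul_mem' := by
    rintro c f ⟨p, hp, hfp⟩
    refine ⟨MvPolynomial.C c * p, fun i => (MvPolynomial.degreeOf_C_mul_le p i c).trans (hp i),
      fun x hx => ?_⟩
    rw [Pi.smul_apply, smul_eq_mul, mul_left_comm, hfp x hx, map_mul, MvPolynomial.eval_C]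

theorem mul_mem_laurentDegreeLE {M M' : ℕ} {f g : (Fin d → K) → K}
    (hf : f ∈ laurentDegreeLE d K M) (hg : g ∈ laurentDegreeLE d K M') :
    f * g ∈ laurentDegreeLE d K (M + M') := by
  obtain ⟨p, hp, hfp⟩ := hf
  obtain ⟨p', hp', hgp'⟩ := hg
  refine ⟨p * p', fun i => ?_, fun x hx => ?_⟩
  · linarith [p.degreeOf_mul_le i p', hp i, hp' i]
  · rw [map_mul, ← hfp x hx, ← hgp' x hx, Pi.mul_apply]
    ring

theorem prod_mem_laurentDegreeLE {ι : Type*} (s : Finset ι) {M : ℕ} {f : ι → (Fin d → K) → K}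
    (hf : ∀ i ∈ s, f i ∈ laurentDegreeLE d K M) :
    ∏ i ∈ s, f i ∈ laurentDegreeLE d K (s.card * M) := by
  classical
  induction s using Finset.induction_on with
  | empty => exact ⟨1, by simp, by simp⟩
  | insert i s hi ih =>
    rw [Finset.prod_insert hi, Finset.card_insert_of_notMem hi, Nat.succ_mul, add_comm]
    exact mul_mem_laurentDegreeLE (hf i (s.mem_insert_self i))
      (ih fun k hk => hf k (Finset.mem_insert_of_mem hk))

theorem det_mem_laurentDegreeLE {m : Type*} [Fintype m] [DecidableEq m] {M : ℕ}
    {A : (Fin d → K) → Matrix m m K} (hA : ∀ a b, (fun x => A x a b) ∈ laurentDegreeLE d K M) :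
    (fun x => (A x).det) ∈ laurentDegreeLE d K (Fintype.card m * M) := by
  have hdet : (fun x => (A x).det) = ∑ σ : Equiv.Perm m,
      ((Equiv.Perm.sign σ : ℤ) : K) • ∏ a, fun x => A x (σ a) a := by
    ext x
    simp [Matrix.det_apply']
  rw [hdet]
  exact sum_mem fun σ _ => Submodule.smul_mem _ _ (prod_mem_laurentDegreeLE _ fun a _ => hA _ _)

theorem sylvester_mem_laurentDegreeLE {m n : Type*} [DecidableEq m] [DecidableEq n] {M : ℕ}
    {A : (Fin d → K) → Matrix m m K} {B : (Fin d → K) → Matrix n n K}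
    (hA : ∀ a b, (fun x => A x a b) ∈ laurentDegreeLE d K M)
    (hB : ∀ a b, (fun x => B x a b) ∈ laurentDegreeLE d K M) (a b : m × n) :
    (fun x => sylvester (A x) (B x) a b) ∈ laurentDegreeLE d K M := by
  have hentry : (fun x => sylvester (A x) (B x) a b) =
      (1 : Matrix n n K) a.2 b.2 • (fun x => A x a.1 b.1) -
        (1 : Matrix m m K) a.1 b.1 • fun x => B x a.2 b.2 := by
    ext x
    simp [sylvester, mul_comm]
  rw [hentry]
  exact sub_mem (Submodule.smul_mem _ _ (hA _ _)) (Submodule.smul_mem _ _ (hB _ _))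

theorem prod_zpow_mem_laurentDegreeLE {M : ℕ} {e : Fin d → ℤ} (he : ∀ i, |e i| ≤ M) :
    (fun x : Fin d → K => ∏ i, x i ^ e i) ∈ laurentDegreeLE d K M := by
  refine ⟨∏ i, .X i ^ (M + e i).toNat, fun i => ?_, fun x hx => ?_⟩
  · have hdeg (k : Fin d) : MvPolynomial.degreeOf i (.X k ^ (M + e k).toNat : MvPolynomial _ K) ≤
        if k = i then 2 * M else 0 := by
      split_ifs with hk
      · subst hk
        rw [MvPolynomial.degreeOf_X_self_pow]
        have := (abs_le.mp (he k)).2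
        omega
      · rw [MvPolynomial.degreeOf_X_pow_of_ne _ (Ne.symm hk)]
    exact (MvPolynomial.degreeOf_prod_le _ _ _).trans
      ((Finset.sum_le_sum fun k _ => hdeg k).trans (by simp))
  · rw [← Finset.prod_pow, ← Finset.prod_mul_distrib, map_prod]
    refine Finset.prod_congr rfl fun i _ => ?_
    have hnonneg : 0 ≤ M + e i := by linarith [(abs_le.mp (he i)).1]
    rw [map_pow, MvPolynomial.eval_X, ← zpow_natCast _ (M + e i).toNat,
      Int.toNat_of_nonneg hnonneg, zpow_add₀ (hx i), zpow_natCast]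

theorem card_zeros_le_of_mem_laurentDegreeLE [DecidableEq K] {M : ℕ} {f : (Fin d → K) → K}
    (hf : f ∈ laurentDegreeLE d K M) (hne : ∃ x, (∀ i, x i ≠ 0) ∧ f x ≠ 0)
    {S : Fin d → Finset K} (hS : ∀ i, 0 ∉ S i) :
    (Finset.card {x ∈ Fintype.piFinset S | f x = 0} : ℝ) / ∏ i, ((S i).card : ℝ) ≤
      ∑ i, (2 * M / (S i).card : ℝ) := by
  obtain ⟨p, hdeg, hp⟩ := hf
  obtain ⟨x₀, hx₀, hfx₀⟩ := hne
  have hp0 : p ≠ 0 := by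
    rintro rfl
    have hprod : ∏ i, x₀ i ≠ 0 := Finset.prod_ne_zero_iff.mpr fun i _ => hx₀ i
    exact mul_ne_zero (pow_ne_zero M hprod) hfx₀ (by simpa using hp x₀ hx₀)
  have hzeros : ({x ∈ Fintype.piFinset S | f x = 0} : Finset (Fin d → K)) ⊆
      {x ∈ Fintype.piFinset S | p.eval x = 0} := by
    intro x hx
    rw [Finset.mem_filter, Fintype.mem_piFinset] at hx ⊢
    have hx0 (i : Fin d) : x i ≠ 0 := fun h => hS i (h ▸ hx.1 i)
    exact ⟨hx.1, by rw [← hp x hx0, hx.2, mul_zero]⟩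
  have hcount : (Finset.card {x ∈ Fintype.piFinset S | f x = 0} : ℚ≥0) /
      ∏ i, ((S i).card : ℚ≥0) ≤ ∑ i, (2 * M / (S i).card : ℚ≥0) := by
    calc _ ≤ (Finset.card {x ∈ Fintype.piFinset S | p.eval x = 0} : ℚ≥0) /
          ∏ i, ((S i).card : ℚ≥0) := by gcongr
      _ ≤ ∑ i, (p.degreeOf i / (S i).card : ℚ≥0) := MvPolynomial.schwartz_zippel_sum_degreeOf hp0 S
      _ ≤ _ := by
          gcongr with i
          exact_mod_cast hdeg i
  have hcast := (NNRat.cast_le (K := ℝ)).mpr hcount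
  push_cast at hcast
  exact hcast

end Laurent

section Translation

variable {d : ℕ} {q : Fin d → ℕ}

theorem abs_le_one_of_mem_neighbors_zero {e : Fin d → ℤ} (he : e ∈ neighbors 0) (i : Fin d) :
    |e i| ≤ 1 := by
  simp only [mem_neighbors, Pi.zero_apply, zero_sub, abs_neg] at he
  exact he ▸ Finset.single_le_sum (f := fun i => |e i|) (fun i _ => abs_nonneg _)
    (Finset.mem_univ i)

theorem single_mem_neighbors_zero (j : Fin d) : Pi.single j 1 ∈ neighbors (0 : Fin d → ℤ) := by
  rw [mem_neighbors, Finset.sum_eq_single j] <;> simp +contextual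

theorem eq_single_of_mem_neighbors_zero {e : Fin d → ℤ} (he : e ∈ neighbors 0) {j : Fin d}
    (hj : e j = 1) : e = Pi.single j 1 := by
  simp only [mem_neighbors, Pi.zero_apply, zero_sub, abs_neg] at he
  rw [← Finset.add_sum_erase _ _ (Finset.mem_univ j), hj, abs_one, add_eq_left,
    Finset.sum_eq_zero_iff_of_nonneg fun i _ => abs_nonneg _] at he
  ext i
  by_cases hi : i = j
  · rw [hi, hj, Pi.single_eq_same]
  · rw [Pi.single_eq_of_ne hi, ← abs_eq_zero]
    exact he i (Finset.mem_erase.mpr ⟨hi, Finset.mem_univ i⟩)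

theorem sum_neighbors {M : Type*} [AddCommMonoid M] (f : (Fin d → ℤ) → M) (n : Fin d → ℤ) :
    ∑ n' ∈ neighbors n, f n' = ∑ e ∈ neighbors 0, f (n + e) :=
  Finset.sum_nbij' (· - n) (n + ·) (by simp [mem_neighbors])
    (by simp [mem_neighbors]) (by simp) (by simp) (by simp)

theorem schrodinger_apply (V : (Fin d → ℤ) → ℝ) (u : (Fin d → ℤ) → ℂ) (n : Fin d → ℤ) :
    schrodinger V u n = ∑ e ∈ neighbors 0, u (n + e) + V n * u n := by
  rw [← sum_neighbors]
  rfl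

/-- The translation `(S_e u)(a) = u(a + e)` of functions on the cell, seen as functions on the
torus `ℤ^d / Γ`. -/
def translation (q : Fin d → ℕ) (e : Fin d → ℤ) : Matrix (Cell q) (Cell q) ℂ :=
  Matrix.of fun a b => if ∀ i, (q i : ℤ) ∣ a.toLattice i + e i - b.toLattice i then 1 else 0

theorem eq_residue_iff (hq : ∀ i, 0 < q i) (b : Cell q) (n : Fin d → ℤ) :
    b = residue q hq n ↔ ∀ i, (q i : ℤ) ∣ n i - b.toLattice i := by
  refine ⟨fun h i => ?_, fun h => Cell.eq_of_dvd _ _ fun i => ?_⟩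
  · rw [h, residue_toLattice]
    exact Int.dvd_self_sub_emod
  · rw [residue_toLattice, ← sub_sub_sub_cancel_left _ _ (n i)]
    exact dvd_sub Int.dvd_self_sub_emod (h i)

theorem translation_eq_one {e : Fin d → ℤ} (he : ∀ i, (q i : ℤ) ∣ e i) : translation q e = 1 := by
  ext a b
  have hiff : (∀ i, (q i : ℤ) ∣ a.toLattice i + e i - b.toLattice i) ↔ a = b := by
    refine ⟨fun h => Cell.eq_of_dvd b a fun i => ?_, fun h i => by simpa [h] using he i⟩
    simpa [add_sub_right_comm, dvd_add_left (he i)] using h i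
  simp [translation, hiff, Matrix.one_apply]

theorem translation_add (hq : ∀ i, 0 < q i) (e e' : Fin d → ℤ) :
    translation q (e + e') = translation q e * translation q e' := by
  ext a b
  have hiff : (∀ i, (q i : ℤ) ∣ (residue q hq (a.toLattice + e)).toLattice i + e' i -
      b.toLattice i) ↔ ∀ i, (q i : ℤ) ∣ a.toLattice i + (e + e') i - b.toLattice i := by
    refine forall_congr' fun i => ?_
    have hres := (eq_residue_iff hq _ (a.toLattice + e)).mp rfl i
    rw [← dvd_add_right hres, Pi.add_apply, Pi.add_apply]
    exact iff_of_eq (congrArg _ (by ring))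
  simp only [translation, Matrix.mul_apply, Matrix.of_apply, ite_mul, one_mul, zero_mul,
    ← Pi.add_apply a.toLattice e, ← eq_residue_iff hq _ (a.toLattice + e), Finset.sum_ite_eq',
    Finset.mem_univ, if_true, hiff]

theorem translation_single_pow (hq : ∀ i, 0 < q i) (j : Fin d) :
    translation q (Pi.single j 1) ^ q j = 1 := by
  have hpow (k : ℕ) :
      translation q (Pi.single j 1) ^ k = translation q (Pi.single j (k : ℤ)) := by
    induction k with
    | zero => simp [translation_eq_one]
    | succ k ih => rw [pow_succ, ih, ← translation_add hq, ← Pi.single_add, Nat.cast_succ]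
  rw [hpow, translation_eq_one fun i => ?_]
  by_cases h : i = j
  · simp [h]
  · simp [h]

end Translation

section Gauge

variable {d : ℕ} (q : Fin d → ℕ) (V : (Fin d → ℤ) → ℝ)

/-- The Floquet matrix in the gauge in which the Floquet-Bloch condition becomes periodicity; the
quasimomentum `k` enters through `x = blochFactor q k`, and `x` is allowed to be complex. -/
def gaugedMatrix (x : Fin d → ℂ) : Matrix (Cell q) (Cell q) ℂ :=
  ∑ e ∈ neighbors 0, (∏ i, x i ^ e i) • translation q e +
    Matrix.diagonal fun a => (V a.toLattice : ℂ)

/-- The factors `e^{2πi k_j / q_j}` that a plane wave of quasimomentum `k` picks up under the unit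
translations of `ℤ^d`. -/
def blochFactor (k : Fin d → ℝ) : Fin d → ℂ :=
  fun j => Complex.exp (2 * Real.pi * Complex.I * k j / q j)

theorem blochFactor_ne_zero (k : Fin d → ℝ) (j : Fin d) : blochFactor q k j ≠ 0 :=
  Complex.exp_ne_zero _

theorem blochFactor_add (k κ : Fin d → ℝ) :
    blochFactor q (k + κ) = blochFactor q κ * blochFactor q k := by
  ext j
  simp only [blochFactor, Pi.mul_apply, Pi.add_apply, ← Complex.exp_add, Complex.ofReal_add]
  ring_nf

variable {q} in
theorem blochFactor_pow_ne_one {κ : Fin d → ℝ} {j : Fin d} (hq : 0 < q j)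
    (hκ : κ j ∉ Set.range ((↑) : ℤ → ℝ)) : blochFactor q κ j ^ q j ≠ 1 := by
  have hq0 : (q j : ℂ) ≠ 0 := by exact_mod_cast hq.ne'
  rw [blochFactor, ← Complex.exp_nat_mul, mul_div_cancel₀ _ hq0, Ne, Complex.exp_eq_one_iff]
  rintro ⟨n, hn⟩
  refine hκ ⟨n, ?_⟩
  rw [mul_comm, mul_left_inj' Complex.two_pi_I_ne_zero] at hn
  exact_mod_cast hn.symm

theorem floquetBasis_eq_prod_zpow (k : Fin d → ℝ) (b : Cell q) (n : Fin d → ℤ) :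
    floquetBasis q k b n = if ∀ i, (q i : ℤ) ∣ n i - b.toLattice i then
      ∏ i, blochFactor q k i ^ (n i - b.toLattice i) else 0 := by
  unfold floquetBasis
  refine if_ctx_congr Iff.rfl (fun h => ?_) fun _ => rfl
  rw [Finset.mul_sum, Complex.exp_sum]
  refine Finset.prod_congr rfl fun i _ => ?_
  obtain ⟨c, hc⟩ := h i
  have hq0 : (q i : ℤ) ≠ 0 := by exact_mod_cast (b i).pos.ne'
  have hq0' : (q i : ℂ) ≠ 0 := by exact_mod_cast hq0
  rw [blochFactor, ← Complex.exp_int_mul, hc, Int.mul_ediv_cancel_left _ hq0]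
  push_cast
  field_simp

theorem floquetMatrix_mul_diagonal (k : Fin d → ℝ) :
    floquetMatrix q V k *
        Matrix.diagonal (fun b : Cell q => ∏ i, blochFactor q k i ^ b.toLattice i) =
      Matrix.diagonal (fun a : Cell q => ∏ i, blochFactor q k i ^ a.toLattice i) *
        gaugedMatrix q V (blochFactor q k) := by
  ext a b
  rw [Matrix.mul_diagonal, Matrix.diagonal_mul]
  simp only [floquetMatrix, schrodinger_apply, Matrix.of_apply, Pi.add_apply, gaugedMatrix,
    Matrix.add_apply, Matrix.sum_apply, Matrix.smul_apply, translation, smul_eq_mul, add_mul,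
    mul_add, Finset.sum_mul, Finset.mul_sum, floquetBasis_eq_prod_zpow q k b (_ + _),
    floquetBasis_toLattice]
  congr 1
  · refine Finset.sum_congr rfl fun e _ => ?_
    rw [ite_mul, zero_mul, mul_ite, mul_ite, mul_one, mul_zero, mul_zero,
      ← Finset.prod_mul_distrib, ← Finset.prod_mul_distrib]
    congr 1
    refine Finset.prod_congr rfl fun i _ => ?_
    rw [← zpow_add₀ (blochFactor_ne_zero q k i), ← zpow_add₀ (blochFactor_ne_zero q k i),
      sub_add_cancel]
  · by_cases h : a = b
    · simp [h, mul_comm]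
    · simp [h]

theorem spectrum_floquetMatrix (k : Fin d → ℝ) :
    spectrum ℂ (floquetMatrix q V k) = spectrum ℂ (gaugedMatrix q V (blochFactor q k)) := by
  have hunit : IsUnit (Matrix.diagonal fun a : Cell q => ∏ i, blochFactor q k i ^ a.toLattice i) :=
    Matrix.isUnit_diagonal.mpr <| Pi.isUnit_iff.mpr fun a => IsUnit.mk0 _ <|
      Finset.prod_ne_zero_iff.mpr fun i _ => zpow_ne_zero _ (blochFactor_ne_zero q k i)
  obtain ⟨D, hD⟩ := hunit
  have hconj : floquetMatrix q V k = D * gaugedMatrix q V (blochFactor q k) *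
      (↑D⁻¹ : Matrix (Cell q) (Cell q) ℂ) := by
    rw [Units.eq_mul_inv_iff_mul_eq, hD]
    exact floquetMatrix_mul_diagonal q V k
  rw [hconj, spectrum.units_conjugate]

variable {q}

theorem band_mem_spectrum (s : Fin (∏ j, q j)) (k : Fin d → ℝ) :
    (band q V s k : ℂ) ∈ spectrum ℂ (floquetMatrix q V k) := by
  have hA := floquetMatrix_isHermitian q V k
  rw [hA.spectrum_eq_image_range]
  refine ⟨_, ⟨Fintype.equivOfCardEq (Fintype.card_fin _) (Fin.rev (Fin.cast (card_cell q) s)),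
    rfl⟩, ?_⟩
  simp [band, Matrix.IsHermitian.eigenvalues]

theorem det_sylvester_gaugedMatrix_eq_zero {k κ : Fin d → ℝ} {s w : Fin (∏ j, q j)}
    (h : band q V s (k + κ) = band q V w k) :
    (sylvester (gaugedMatrix q V (blochFactor q κ * blochFactor q k))
      (gaugedMatrix q V (blochFactor q k))).det = 0 := by
  have hs := band_mem_spectrum V s (k + κ)
  have hw := band_mem_spectrum V w k
  rw [spectrum_floquetMatrix, blochFactor_add, h] at hs
  rw [spectrum_floquetMatrix] at hw
  exact det_sylvester_eq_zero_of_mem_spectrum hs hw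

theorem gaugedMatrix_mem_laurentDegreeLE (y : Fin d → ℂ) (a b : Cell q) :
    (fun x => gaugedMatrix q V (y * x) a b) ∈ laurentDegreeLE d ℂ 1 := by
  have hentry : (fun x => gaugedMatrix q V (y * x) a b) =
      ∑ e ∈ neighbors 0, ((∏ i, y i ^ e i) * translation q e a b) •
        (fun x : Fin d → ℂ => ∏ i, x i ^ e i) +
      Matrix.diagonal (fun a => (V a.toLattice : ℂ)) a b •
        fun x : Fin d → ℂ => ∏ i, x i ^ (0 : Fin d → ℤ) i := by
    ext x
    simp [gaugedMatrix, Matrix.sum_apply, mul_zpow, Finset.prod_mul_distrib, mul_right_comm]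
  rw [hentry]
  refine add_mem (sum_mem fun e he => Submodule.smul_mem _ _ ?_) (Submodule.smul_mem _ _ ?_)
  · exact prod_zpow_mem_laurentDegreeLE (abs_le_one_of_mem_neighbors_zero he)
  · exact prod_zpow_mem_laurentDegreeLE (by simp)

theorem det_sylvester_gaugedMatrix_mem_laurentDegreeLE (y : Fin d → ℂ) :
    (fun x => (sylvester (gaugedMatrix q V (y * x)) (gaugedMatrix q V x)).det) ∈
      laurentDegreeLE d ℂ ((∏ j, q j) ^ 2) := by
  have hdet := det_mem_laurentDegreeLE <| sylvester_mem_laurentDegreeLE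
    (gaugedMatrix_mem_laurentDegreeLE (q := q) V y) (gaugedMatrix_mem_laurentDegreeLE (q := q) V 1)
  simpa only [one_mul, mul_one, Fintype.card_prod, ← card_cell, ← sq] using hdet

end Gauge

section Limit

open Bornology

variable {d : ℕ} {q : Fin d → ℕ} (V : (Fin d → ℤ) → ℝ)

theorem tendsto_zpow_cobounded_zero {K : Type*} [NormedField K] {m : ℤ} (hm : m < 0) :
    Tendsto (fun t : K => t ^ m) (cobounded K) (𝓝 0) := by
  obtain ⟨k, rfl⟩ := Int.eq_negSucc_of_lt_zero hm
  simpa [zpow_negSucc] using (tendsto_inv₀_cobounded (α := K)).pow (k + 1)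

theorem tendsto_inv_mul_prod_zpow (c : Fin d → ℂ) (j : Fin d) {e : Fin d → ℤ}
    (he : e ∈ neighbors 0) :
    Tendsto (fun t : ℂ => t⁻¹ * ∏ i, (c * Pi.mulSingle j t : Fin d → ℂ) i ^ e i) (cobounded ℂ)
      (𝓝 (if e = Pi.single j 1 then c j else 0)) := by
  have hprod (t : ℂ) :
      ∏ i, (c * Pi.mulSingle j t : Fin d → ℂ) i ^ e i = (∏ i, c i ^ e i) * t ^ e j := by
    simp only [Pi.mul_apply, mul_zpow, Finset.prod_mul_distrib]
    congr 1
    rw [Finset.prod_eq_single j] <;> simp +contextual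
  have heq : (fun t : ℂ => (∏ i, c i ^ e i) * t ^ (e j - 1)) =ᶠ[cobounded ℂ]
      fun t => t⁻¹ * ∏ i, (c * Pi.mulSingle j t : Fin d → ℂ) i ^ e i := by
    filter_upwards [eventually_ne_cobounded 0] with t ht
    rw [hprod, zpow_sub_one₀ ht]
    ring
  refine Tendsto.congr' heq ?_
  split_ifs with h
  · have hc : ∏ i, c i ^ e i = c j := by
      rw [h, Finset.prod_eq_single j] <;> simp +contextual
    simp only [hc]
    simp [h]
  · have hneg : e j - 1 < 0 := by
      have hle := (abs_le.mp (abs_le_one_of_mem_neighbors_zero he j)).2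
      have hne : e j ≠ 1 := fun hj => h (eq_single_of_mem_neighbors_zero he hj)
      omega
    simpa using (tendsto_zpow_cobounded_zero hneg).const_mul (∏ i, c i ^ e i)

theorem tendsto_inv_smul_gaugedMatrix (c : Fin d → ℂ) (j : Fin d) :
    Tendsto (fun t => t⁻¹ • gaugedMatrix q V (c * Pi.mulSingle j t)) (cobounded ℂ)
      (𝓝 (c j • translation q (Pi.single j 1))) := by
  have hhop := tendsto_finsetSum (neighbors 0) fun e he =>
    (tendsto_inv_mul_prod_zpow c j he).smul_const (translation q e)
  have hpot := (tendsto_inv₀_cobounded (α := ℂ)).smul_const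
    (Matrix.diagonal fun a : Cell q => (V a.toLattice : ℂ))
  simpa only [gaugedMatrix, smul_add, Finset.smul_sum, smul_smul, ite_smul, zero_smul,
    Finset.sum_ite_eq', single_mem_neighbors_zero, if_true, add_zero] using hhop.add hpot

theorem exists_det_sylvester_gaugedMatrix_ne_zero (hq : ∀ i, 0 < q i) {y : Fin d → ℂ} {j : Fin d}
    (hy : y j ^ q j ≠ 1) : ∃ x : Fin d → ℂ, (∀ i, x i ≠ 0) ∧
      (sylvester (gaugedMatrix q V (y * x)) (gaugedMatrix q V x)).det ≠ 0 := by
  set S := translation q (Pi.single j 1) with hS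
  have hdet : (sylvester (y j • S) ((1 : Fin d → ℂ) j • S)).det ≠ 0 := by
    refine det_sylvester_ne_zero_of_pow (k := q j) (c' := 1) ?_ ?_ hy
    · rw [smul_pow, hS, translation_single_pow hq]
    · rw [smul_pow, hS, translation_single_pow hq, Pi.one_apply, one_pow]
  have hcont : Continuous fun P : Matrix (Cell q) (Cell q) ℂ × Matrix (Cell q) (Cell q) ℂ =>
      (sylvester P.1 P.2).det := by
    refine Continuous.matrix_det (continuous_matrix fun a b => ?_)
    simp only [sylvester, Matrix.sub_apply, Matrix.kroneckerMap_apply]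
    fun_prop
  have hlim := (hcont.tendsto _).comp ((tendsto_inv_smul_gaugedMatrix V y j).prodMk_nhds
    (tendsto_inv_smul_gaugedMatrix (q := q) V 1 j))
  obtain ⟨t, ht, ht0⟩ := ((hlim.eventually_ne hdet).and (eventually_ne_cobounded 0)).exists
  refine ⟨Pi.mulSingle j t, fun i => ?_, fun h => ht ?_⟩
  · by_cases hi : i = j
    · simpa [hi] using ht0
    · simp [hi]
  · simp only [Function.comp_apply, one_mul, sylvester_smul, Matrix.det_smul, h, mul_zero]

end Limit

section Grid

variable {d : ℕ} {q : Fin d → ℕ}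

theorem injOn_exp_div {N p : ℕ} (hN : 0 < N) (hp : 0 < p) :
    Set.InjOn (fun r : ℕ => Complex.exp (2 * Real.pi * Complex.I * ((r / N : ℝ) : ℂ) / p))
      (Finset.range N) := by
  have hζ := Complex.isPrimitiveRoot_exp (N * p) (Nat.mul_pos hN hp).ne'
  have hpow (r : ℕ) : Complex.exp (2 * Real.pi * Complex.I * ((r / N : ℝ) : ℂ) / p) =
      Complex.exp (2 * Real.pi * Complex.I / (N * p : ℕ)) ^ r := by
    rw [← Complex.exp_nat_mul]
    congr 1
    push_cast
    field_simp
  have hlt {r : ℕ} (hr : r ∈ (Finset.range N : Set ℕ)) : r < N * p :=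
    (Finset.mem_range.mp hr).trans_le (Nat.le_mul_of_pos_right N hp)
  intro r hr r' hr' h
  simp only [hpow] at h
  exact hζ.pow_inj (hlt hr) (hlt hr') h

theorem div_notMem_range_intCast {m N : ℕ} (hm : m ≠ 0) (hmN : m < N) :
    (m / N : ℝ) ∉ Set.range ((↑) : ℤ → ℝ) := by
  rintro ⟨n, hn⟩
  have hN : (N : ℝ) ≠ 0 := by exact_mod_cast (Nat.zero_lt_of_lt hmN).ne'
  rw [eq_div_iff hN] at hn
  have hdvd : (N : ℤ) ∣ m := ⟨n, by rw [mul_comm]; exact_mod_cast hn.symm⟩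
  exact absurd (Nat.le_of_dvd (Nat.pos_of_ne_zero hm) (Int.natCast_dvd_natCast.mp hdvd)) hmN.not_ge

theorem card_box_filter_le {f : (Fin d → ℂ) → ℂ} {M : ℕ} (hf : f ∈ laurentDegreeLE d ℂ M)
    (hne : ∃ x, (∀ i, x i ≠ 0) ∧ f x ≠ 0) (hq : ∀ j, 0 < q j) {N : ℕ} (hN : 0 < N) :
    (Finset.card {r ∈ box d N | f (blochFactor q fun j => r j / N) = 0} : ℝ) / N ^ d ≤
      2 * d * M / N := by
  let S (j : Fin d) : Finset ℂ := (Finset.range N).image fun r : ℕ =>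
    Complex.exp (2 * Real.pi * Complex.I * ((r / N : ℝ) : ℂ) / q j)
  have hcardS (j : Fin d) : (S j).card = N := by
    rw [Finset.card_image_of_injOn (injOn_exp_div hN (hq j)), Finset.card_range]
  have hcard : Finset.card {r ∈ box d N | f (blochFactor q fun j => r j / N) = 0} ≤
      Finset.card {x ∈ Fintype.piFinset S | f x = 0} := by
    refine Finset.card_le_card_of_injOn (fun r => blochFactor q fun j => r j / N) ?_ ?_
    · intro r hr
      rw [Finset.mem_coe, Finset.mem_filter, box, Fintype.mem_piFinset] at hr
      rw [Finset.mem_coe, Finset.mem_filter, Fintype.mem_piFinset]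
      exact ⟨fun j => Finset.mem_image_of_mem _ (hr.1 j), hr.2⟩
    · intro r hr r' hr' h
      rw [Finset.mem_coe, Finset.mem_filter, box, Fintype.mem_piFinset] at hr hr'
      exact funext fun j => injOn_exp_div hN (hq j) (hr.1 j) (hr'.1 j) (congrFun h j)
  have hzeros := card_zeros_le_of_mem_laurentDegreeLE hf hne (S := S) (by simp [S])
  simp only [hcardS, Finset.prod_const, Finset.sum_const, Finset.card_univ, Fintype.card_fin,
    nsmul_eq_mul] at hzeros
  calc _ ≤ (Finset.card {x ∈ Fintype.piFinset S | f x = 0} : ℝ) / N ^ d := by gcongr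
    _ ≤ d * (2 * M / N) := by exact_mod_cast hzeros
    _ = 2 * d * M / N := by ring

theorem tendsto_iSup_zero_of_le {α : Type*} {l : Filter α} {ι : α → Type*} {f : ∀ a, ι a → ℝ}
    {g : α → ℝ} (hf : ∀ a i, 0 ≤ f a i) (hfg : ∀ᶠ a in l, ∀ i, f a i ≤ g a)
    (hg : Tendsto g l (𝓝 0)) : Tendsto (fun a => ⨆ i, f a i) l (𝓝 0) := by
  have habs : Tendsto (fun a => |g a|) l (𝓝 0) := by simpa using hg.abs
  refine squeeze_zero' (.of_forall fun a => Real.iSup_nonneg (hf a)) ?_ habs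
  filter_upwards [hfg] with a ha
  exact Real.iSup_le (fun i => (ha i).trans (le_abs_self _)) (abs_nonneg _)

theorem card_band_sub_band_eq_zero_div_le (hq : ∀ j, 0 < q j) (V : (Fin d → ℤ) → ℝ)
    (s w : Fin (∏ j, q j)) {κ : Fin d → ℝ} {j : Fin d} (hκ : κ j ∉ Set.range ((↑) : ℤ → ℝ))
    {N : ℕ} (hN : 0 < N) :
    (Finset.card {r ∈ box d N |
        band q V s (fun j => r j / N + κ j) - band q V w (fun j => r j / N) = 0} : ℝ) / N ^ d ≤
      2 * d * (∏ j, (q j : ℝ)) ^ 2 / N := by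
  have hzeros := card_box_filter_le
    (det_sylvester_gaugedMatrix_mem_laurentDegreeLE (q := q) V (blochFactor q κ))
    (exists_det_sylvester_gaugedMatrix_ne_zero V hq (blochFactor_pow_ne_one (hq j) hκ)) hq hN
  push_cast at hzeros
  refine le_trans ?_ hzeros
  gcongr with r
  exact fun h => det_sylvester_gaugedMatrix_eq_zero V (sub_eq_zero.mp h)

end Grid

end PeriodicSchrodinger

end

theorem corollary1p8 (d : ℕ) (q : Fin d → ℕ) (hq : ∀ j, 0 < q j)
    (V : (Fin d → ℤ) → ℝ) (hV : PeriodicSchrodinger.IsPeriodic q V)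
    (s w : Fin (∏ j, q j)) :
    Tendsto
      (fun N : ℕ =>
        ⨆ m : {m : Fin d → ℕ // m ∈ PeriodicSchrodinger.box d N ∧ m ≠ 0},
          ((Finset.card {r ∈ PeriodicSchrodinger.box d N |
              PeriodicSchrodinger.band q V s (fun j => ((r j : ℝ) + (m.1 j : ℝ)) / (N : ℝ)) -
                PeriodicSchrodinger.band q V w (fun j => (r j : ℝ) / (N : ℝ)) = 0} : ℕ) : ℝ) /
            (N : ℝ) ^ d)
      atTop (𝓝 0) := by
  refine PeriodicSchrodinger.tendsto_iSup_zero_of_le (fun N m => by positivity) ?_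
    (tendsto_const_div_atTop_nhds_zero_nat (2 * d * (∏ j, (q j : ℝ)) ^ 2))
  filter_upwards [eventually_gt_atTop 0] with N hN
  rintro ⟨m, hm, hm0⟩
  obtain ⟨j, hj⟩ := Function.ne_iff.mp hm0
  have hmN : m j < N := Finset.mem_range.mp (Fintype.mem_piFinset.mp hm j)
  simpa [add_div] using PeriodicSchrodinger.card_band_sub_band_eq_zero_div_le hq V s w
    (κ := fun j => m j / N) (PeriodicSchrodinger.div_notMem_range_intCast hj hmN) hN
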